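/- Let $D=(S\uplus I\uplus T,E)$ be a finite directed acyclic graph in which the vertices of $S$ are sources (no in-edges), those of $T$ are sinks (no out-edges), and every internal vertex $v\in I$ has at least one in-neighbour and at least one out-neighbour. Eliminating $v\in I$ means deleting $v$ and adding every edge $(u,w)$ with $u\in N^-(v)$, $w\in N^+(v)$ that is not yet present; its cost is $|N^-(v)|\cdot|N^+(v)|$ at the time of elimination. A total elimination sequence lists every vertex of $I$ exactly once; its cost is the sum of the costs of its eliminations, and $\mathrm{OPT}(D)$ is the minimum cost of a total elimination sequence (Optimal Vertex Elimination). Forward mode $\mathrm{Fw}$ (reverse mode $\mathrm{Rev}$) eliminates all internal vertices of a graph in an arbitrary topological (reverse topological) order, i.e. no edge between two internal vertices goes from a later to an earlier (from an earlier to a later) vertex of the sequence. Let $C\subseteq S\cup I\cup T$ be an $S$–$T$ separator in the underlying undirected graph of $D$: every undirected path between a vertex of $S$ and a vertex of $T$ contains a vertex of $C$ (which may be one of its endpoints). Let $V^L$ (resp. $V^R$) be the set of vertices of $D\setminus C$ lying in an undirected connected component of $D\setminus C$ that contains a vertex of $S$ (resp. $T$), and let $V^1,\dots,V^k$ be the vertex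 sets of the remaining components of $D\setminus C$. Write $E(C)$ for the edges with both ends in $C$ and $E(A,B)$ for the edges from $A$ to $B$. Put $D^L=D[V^L\cup C]\setminus(E(C)\cup E(S,C))$, $D^R=D[V^R\cup C]\setminus(E(C)\cup E(C,T))$ and $D^i=D[V^i\cup C]\setminus E(C)$, each with its isolated vertices of $C$ removed; in each of these graphs the vertices of $C$ are terminals, so that the internal vertices are $I\cap V^L$, $I\cap V^R$ and $I\cap V^i$, respectively. The algorithm $\mathrm{MiddleOut}(D,C)$ returns the concatenation of $\mathrm{Rev}(D^L)$, $\mathrm{Fw}(D^R)$, $\mathrm{Fw}(D^1),\dots,\mathrm{Fw}(D^k)$ (the components in any order) and $\mathrm{Fw}(D')$, where $D'$ is the graph obtained from $D$ by eliminating the vertices listed so far, that is, those of $I\setminus C$. **Theorem.** $\mathrm{MiddleOut}(D,C)$ is an $O(|C|^2)$-approximation for Optimal Vertex Elimination: there is an absolute constant $K$ such that, for all such $D$ and $C$, the algorithm has an output, and every possible output is a total elimination sequence of $D$ of cost at most $K|C|^2\cdot\mathrm{OPT}(D)$. Concretely, every possible output has cost at most $$\frac{|C|^2+7|C|}{2}\cdot\mathrm{OPT}(D).$$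 -/

import Mathlib

/-- The data `D = (S ⊎ I ⊎ T, E)`: vertices given by three finite sets (sources, internal vertices,
sinks) of an ambient type `V`, and a finite set `E` of directed edges `(u, v)`, from `u` to `v`.
The conditions that make it a DAG with sources `S` and sinks `T` are in `CompGraph.IsCompDAG`. -/
@[ext]
structure CompGraph (V : Type*) where
  S : Finset V
  I : Finset V
  T : Finset V
  E : Finset (V × V)

namespace CompGraph

variable {V : Type*} [DecidableEq V]

/-- The vertex set `S ∪ I ∪ T`. -/
def verts (D : CompGraph V) : Finset V := D.S ∪ D.I ∪ D.T

/-- `D` is a directed acyclic graph whose vertex set is the disjoint union of `S`, `I`, `T`, where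
`S` consists of sources, `T` of sinks, and the internal vertices are neither sources nor sinks. -/
structure IsCompDAG (D : CompGraph V) : Prop where
  disjoint_S_I : Disjoint D.S D.I
  disjoint_S_T : Disjoint D.S D.T
  disjoint_I_T : Disjoint D.I D.T
  edge_mem : ∀ u v, (u, v) ∈ D.E → u ∈ D.verts ∧ v ∈ D.verts
  acyclic : ∀ v, ¬ Relation.TransGen (fun a b => (a, b) ∈ D.E) v v
  source : ∀ s ∈ D.S, ∀ u, (u, s) ∉ D.E
  sink : ∀ t ∈ D.T, ∀ w, (t, w) ∉ D.E
  internal_in : ∀ v ∈ D.I, ∃ u, (u, v) ∈ D.E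
  internal_out : ∀ v ∈ D.I, ∃ w, (v, w) ∈ D.E

/-! ### Vertex elimination -/

/-- In-neighbours of `v`. -/
def inNbrs (D : CompGraph V) (v : V) : Finset V := D.verts.filter fun u => (u, v) ∈ D.E

/-- Out-neighbours of `v`. -/
def outNbrs (D : CompGraph V) (v : V) : Finset V := D.verts.filter fun w => (v, w) ∈ D.E

/-- The Markowitz degree of `v`: the cost of eliminating `v` from `D`. -/
def markowitz (D : CompGraph V) (v : V) : ℕ := (D.inNbrs v).card * (D.outNbrs v).card

/-- Elimination of the internal vertex `v`: delete `v`, and add every edge from an in-neighbour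
to an out-neighbour of `v`. -/
def elim (D : CompGraph V) (v : V) : CompGraph V where
  S := D.S
  I := D.I.erase v
  T := D.T
  E := D.E.filter (fun e => e.1 ≠ v ∧ e.2 ≠ v) ∪ D.inNbrs v ×ˢ D.outNbrs v

/-- The graph obtained from `D` by eliminating the vertices of a list one after the other. -/
def elimSeq (D : CompGraph V) : List V → CompGraph V
  | [] => D
  | v :: σ => (D.elim v).elimSeq σ

/-- The cost of an elimination sequence: the sum, over its vertices, of the Markowitz degree at
the time of elimination. -/
def cost (D : CompGraph V) : List V → ℕ
  | [] => 0
  | v :: σ => D.markowitz v + (D.elim v).cost σ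

/-- `σ` lists every internal vertex of `D` exactly once. -/
def IsTotalSeq (D : CompGraph V) (σ : List V) : Prop := σ.Nodup ∧ σ.toFinset = D.I

/-- The minimum cost of a total elimination sequence. -/
noncomputable def opt (D : CompGraph V) : ℕ := sInf {c | ∃ σ, D.IsTotalSeq σ ∧ D.cost σ = c}

/-- The infimum in `opt` is attained, so it is a minimum. -/
theorem opt_isLeast (D : CompGraph V) :
    IsLeast {c | ∃ σ, D.IsTotalSeq σ ∧ D.cost σ = c} D.opt :=
  ⟨Nat.sInf_mem ⟨_, D.I.toList, ⟨D.I.nodup_toList, D.I.toList_toFinset⟩, rfl⟩,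
    fun _ hc => Nat.sInf_le hc⟩

/-- A possible output of forward mode `Fw(D)`: the internal vertices in a topological order. -/
def IsFw (D : CompGraph V) (σ : List V) : Prop :=
  D.IsTotalSeq σ ∧ σ.Pairwise fun a b => (b, a) ∉ D.E

/-- A possible output of reverse mode `Rev(D)`: the internal vertices in a reverse topological
order. -/
def IsRev (D : CompGraph V) (σ : List V) : Prop :=
  D.IsTotalSeq σ ∧ σ.Pairwise fun a b => (a, b) ∉ D.E

/-! ### Separators and the pieces of `D ∖ C` -/

/-- The underlying undirected graph. -/
def undirected (D : CompGraph V) : SimpleGraph V := SimpleGraph.fromRel fun a b => (a, b) ∈ D.E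

/-- `C` is a set of vertices of `D` that meets every path between `S` and `T` in the underlying
undirected graph. -/
def IsSeparator (D : CompGraph V) (C : Finset V) : Prop :=
  C ⊆ D.verts ∧ ∀ s ∈ D.S, ∀ t ∈ D.T, ∀ p : D.undirected.Walk s t, p.IsPath →
    ∃ c ∈ C, c ∈ p.support

/-- `D ∖ C`: delete the vertices of `C`. -/
def delete (D : CompGraph V) (C : Finset V) : CompGraph V where
  S := D.S \ C
  I := D.I \ C
  T := D.T \ C
  E := D.E.filter fun e => e.1 ∉ C ∧ e.2 ∉ C

open Classical in
/-- The vertices of `D ∖ C` in the same (undirected) component of `D ∖ C` as some vertex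
of `A`. -/
noncomputable def reach (D : CompGraph V) (C A : Finset V) : Finset V :=
  (D.delete C).verts.filter fun v => ∃ a ∈ A \ C, (D.delete C).undirected.Reachable a v

/-- `V^L`: the vertices reachable in `D ∖ C` from some source. -/
noncomputable def leftVerts (D : CompGraph V) (C : Finset V) : Finset V := D.reach C D.S

/-- `V^R`: the vertices reachable in `D ∖ C` from some sink. -/
noncomputable def rightVerts (D : CompGraph V) (C : Finset V) : Finset V := D.reach C D.T

/-- The vertex sets `V^1, …, V^k` of the components of `D ∖ C` formed by the vertices outside
`C ∪ V^L ∪ V^R`. -/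
noncomputable def middleParts (D : CompGraph V) (C : Finset V) : Finset (Finset V) :=
  (D.verts \ (C ∪ D.leftVerts C ∪ D.rightVerts C)).image fun v => D.reach C {v}

/-- The edges of `D[W ∪ C] ∖ E(C)`. -/
def pieceEdges (D : CompGraph V) (C W : Finset V) : Finset (V × V) :=
  D.E.filter fun e => e.1 ∈ W ∪ C ∧ e.2 ∈ W ∪ C ∧ ¬ (e.1 ∈ C ∧ e.2 ∈ C)

/-- The edges of `D^L = D[V^L ∪ C] ∖ (E(C) ∪ E(S, C))`. -/
noncomputable def leftEdges (D : CompGraph V) (C : Finset V) : Finset (V × V) :=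
  (D.pieceEdges C (D.leftVerts C)).filter fun e => ¬ (e.1 ∈ D.S ∧ e.2 ∈ C)

/-- The edges of `D^R = D[V^R ∪ C] ∖ (E(C) ∪ E(C, T))`. -/
noncomputable def rightEdges (D : CompGraph V) (C : Finset V) : Finset (V × V) :=
  (D.pieceEdges C (D.rightVerts C)).filter fun e => ¬ (e.1 ∈ C ∧ e.2 ∈ D.T)

/-- `D^L`. The vertices of `C` are terminals, placed on the sink side, and those that are isolated
in `D^L` are pruned; the internal vertices are those of `D` in `V^L`. -/
noncomputable def leftGraph (D : CompGraph V) (C : Finset V) : CompGraph V where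
  S := D.S ∩ D.leftVerts C
  I := D.I ∩ D.leftVerts C
  T := C.filter fun c => ∃ e ∈ D.leftEdges C, e.1 = c ∨ e.2 = c
  E := D.leftEdges C

/-- `D^R`. The vertices of `C` are terminals, placed on the source side, and those that are
isolated in `D^R` are pruned; the internal vertices are those of `D` in `V^R`. -/
noncomputable def rightGraph (D : CompGraph V) (C : Finset V) : CompGraph V where
  S := C.filter fun c => ∃ e ∈ D.rightEdges C, e.1 = c ∨ e.2 = c
  I := D.I ∩ D.rightVerts C
  T := D.T ∩ D.rightVerts C
  E := D.rightEdges C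

/-- `D^i = D[W ∪ C] ∖ E(C)` for `W = V^i`. The terminals are the vertices of `C` that are
not isolated: tails of edges are sources, heads of edges are sinks. -/
def middleGraph (D : CompGraph V) (C W : Finset V) : CompGraph V where
  S := C.filter fun c => ∃ e ∈ D.pieceEdges C W, e.1 = c
  I := D.I ∩ W
  T := C.filter fun c => ∃ e ∈ D.pieceEdges C W, e.2 = c
  E := D.pieceEdges C W

/-! ### The algorithm and the approximation guarantee -/

/-- `σ` is a possible output of `MiddleOut(D, C)`: a reverse-mode order of `D^L`, then a
forward-mode order of `D^R`, then forward-mode orders of `D^1, …, D^k` (for some enumeration of the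
middle components), then a forward-mode order of the graph that remains once all these vertices
have been eliminated from `D`. -/
def IsMiddleOut (D : CompGraph V) (C : Finset V) (σ : List V) : Prop :=
  ∃ (σL σR : List V) (parts : List (Finset V)) (σM : List (List V)) (σC : List V),
    (D.leftGraph C).IsRev σL ∧
    (D.rightGraph C).IsFw σR ∧
    parts.Nodup ∧ parts.toFinset = D.middleParts C ∧
    List.Forall₂ (fun W τ => (D.middleGraph C W).IsFw τ) parts σM ∧
    (D.elimSeq (σL ++ σR ++ σM.flatten)).IsFw σC ∧
    σ = σL ++ σR ++ σM.flatten ++ σC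

/-- An algorithm with possible outputs `A` on the instance `D` is a `ρ`-approximation for Optimal
Vertex Elimination there: it has an output, and each of its outputs is a total elimination sequence
of cost at most `ρ` times the optimum. -/
def IsApproximation (D : CompGraph V) (A : List V → Prop) (ρ : ℝ) : Prop :=
  (∃ σ, A σ) ∧ ∀ σ, A σ → D.IsTotalSeq σ ∧ (D.cost σ : ℝ) ≤ ρ * D.opt

end CompGraph

/-!
Write `k = |C|`. Two quantities bound the cost of *every* total elimination sequence from below,
each by following how it changes under one elimination.

* `card_incidentEdges_le`: the number `m` of edges with an internal end is at most `2 · OPT`.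
  Eliminating `v` with `a` in-neighbours and `b` out-neighbours destroys only the `a + b` edges at
  `v`, and `a + b ≤ 2ab` since `a, b ≥ 1`.
* `card_throughPairs_le`: the number `p` of pairs `(s, t)` of a source and a sink joined by a
  directed path with an internal vertex is at most `OPT`. A pair stops being joined through an
  internal vertex only when some `v` with `s ∈ N⁻(v)` and `t ∈ N⁺(v)` is eliminated.

The cost of the algorithm is bounded from above in terms of `m` and `p`.

* Vertices outside `C`. In reverse mode on the left part, the in-neighbourhoods of the remaining
  vertices never grow, and at the time of its elimination all out-neighbours of `v` lie in `C`
  (`cost_le_of_reverse`). Hence `v` costs at most `k` times its original in-degree. The right and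
  the middle parts, where sources can only occur in `C`, are the mirror image
  (`cost_le_of_forward`). Eliminating vertices of one part does not affect the edges at the
  vertices of another, and no edge is counted twice, so all of this costs at most `k · m`.
* Vertices of `I ∩ C`. In forward mode the in-neighbours of `v` are sources when `v` is eliminated,
  while its out-neighbours are sinks or vertices still to be eliminated. The pairs formed with
  sinks are counted in `p`, and the number of in-neighbours is at most `p`, because `v` reaches
  some sink. So `v` costs at most `(1 + r) · p` if `r` vertices remain, and the total is at most
  `k (k + 1) / 2 · p` (`two_mul_cost_le_of_isFw`).

Altogether the cost is at most `(k² + 5k) / 2 · OPT`.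
-/

namespace CompGraph

variable {V : Type*} [DecidableEq V]

/-! ### Elimination and directed reachability -/

theorem mem_inNbrs {D : CompGraph V} {u v : V} :
    u ∈ D.inNbrs v ↔ u ∈ D.verts ∧ (u, v) ∈ D.E := Finset.mem_filter

theorem mem_outNbrs {D : CompGraph V} {v w : V} :
    w ∈ D.outNbrs v ↔ w ∈ D.verts ∧ (v, w) ∈ D.E := Finset.mem_filter

theorem mem_verts {D : CompGraph V} {v : V} : v ∈ D.verts ↔ v ∈ D.S ∨ v ∈ D.I ∨ v ∈ D.T := by
  simp [verts]

theorem mem_elim_E {D : CompGraph V} {v a b : V} :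
    (a, b) ∈ (D.elim v).E ↔
      ((a, b) ∈ D.E ∧ a ≠ v ∧ b ≠ v) ∨ (a ∈ D.inNbrs v ∧ b ∈ D.outNbrs v) := by
  simp [elim]

theorem elim_verts_subset (D : CompGraph V) (v : V) : (D.elim v).verts ⊆ D.verts := by
  intro x
  simp only [mem_verts, elim, Finset.mem_erase]
  tauto

/-- `D.Reaches a b`: there is a directed path with at least one edge from `a` to `b`. -/
abbrev Reaches (D : CompGraph V) : V → V → Prop :=
  Relation.TransGen fun a b => (a, b) ∈ D.E

theorem Reaches.elim_le {D : CompGraph V} {v a b : V} (h : (D.elim v).Reaches a b) :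
    D.Reaches a b := by
  refine Relation.TransGen.trans_induction_on h ?_ (fun _ _ h₁ h₂ => h₁.trans h₂)
  intro a b hab
  rcases mem_elim_E.1 hab with h | ⟨ha, hb⟩
  · exact .single h.1
  · exact .tail (.single (mem_inNbrs.1 ha).2) (mem_outNbrs.1 hb).2

theorem IsCompDAG.mem_inNbrs_iff {D : CompGraph V} (hD : D.IsCompDAG) {u v : V} :
    u ∈ D.inNbrs v ↔ (u, v) ∈ D.E :=
  mem_inNbrs.trans ⟨And.right, fun h => ⟨(hD.edge_mem _ _ h).1, h⟩⟩

theorem IsCompDAG.mem_outNbrs_iff {D : CompGraph V} (hD : D.IsCompDAG) {v w : V} :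
    w ∈ D.outNbrs v ↔ (v, w) ∈ D.E :=
  mem_outNbrs.trans ⟨And.right, fun h => ⟨(hD.edge_mem _ _ h).2, h⟩⟩

theorem IsCompDAG.not_loop {D : CompGraph V} (hD : D.IsCompDAG) (v : V) : (v, v) ∉ D.E :=
  fun h => hD.acyclic v (.single h)

theorem IsCompDAG.mem_I_of_reaches {D : CompGraph V} (hD : D.IsCompDAG) {a x b : V}
    (ha : D.Reaches a x) (hb : D.Reaches x b) : x ∈ D.I := by
  obtain ⟨u, _, hu⟩ := Relation.TransGen.tail'_iff.1 ha
  obtain ⟨w, hw, _⟩ := Relation.TransGen.head'_iff.1 hb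
  rcases mem_verts.1 (hD.edge_mem _ _ hu).2 with h | h | h
  · exact absurd hu (hD.source x h u)
  · exact h
  · exact absurd hw (hD.sink x h w)

theorem IsCompDAG.elim {D : CompGraph V} (hD : D.IsCompDAG) {v : V} (hv : v ∈ D.I) :
    (D.elim v).IsCompDAG where
  disjoint_S_I := hD.disjoint_S_I.mono_right (Finset.erase_subset _ _)
  disjoint_S_T := hD.disjoint_S_T
  disjoint_I_T := hD.disjoint_I_T.mono_left (Finset.erase_subset _ _)
  edge_mem a b h := by
    have key : ∀ x ∈ D.verts, x ≠ v → x ∈ (D.elim v).verts := by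
      intro x hx hxv
      simp only [mem_verts, CompGraph.elim, Finset.mem_erase] at hx ⊢
      tauto
    rcases mem_elim_E.1 h with ⟨h, ha, hb⟩ | ⟨ha, hb⟩
    · exact ⟨key a (hD.edge_mem _ _ h).1 ha, key b (hD.edge_mem _ _ h).2 hb⟩
    · refine ⟨key a (mem_inNbrs.1 ha).1 ?_, key b (mem_outNbrs.1 hb).1 ?_⟩
      · rintro rfl
        exact hD.not_loop _ (mem_inNbrs.1 ha).2
      · rintro rfl
        exact hD.not_loop _ (mem_outNbrs.1 hb).2
  acyclic x h := hD.acyclic x (Reaches.elim_le h)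
  source s hs u h := by
    obtain ⟨x, _, hx⟩ := Relation.TransGen.tail'_iff.1 (Reaches.elim_le (.single h))
    exact hD.source s hs x hx
  sink t ht w h := by
    obtain ⟨x, hx, _⟩ := Relation.TransGen.head'_iff.1 (Reaches.elim_le (.single h))
    exact hD.sink t ht x hx
  internal_in x hx := by
    obtain ⟨hxv, hx⟩ := Finset.mem_erase.1 hx
    obtain ⟨u, hu⟩ := hD.internal_in x hx
    by_cases huv : u = v
    · subst huv
      obtain ⟨y, hy⟩ := hD.internal_in u hv
      exact ⟨y, mem_elim_E.2 (.inr ⟨hD.mem_inNbrs_iff.2 hy, hD.mem_outNbrs_iff.2 hu⟩)⟩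
    · exact ⟨u, mem_elim_E.2 (.inl ⟨hu, huv, hxv⟩)⟩
  internal_out x hx := by
    obtain ⟨hxv, hx⟩ := Finset.mem_erase.1 hx
    obtain ⟨w, hw⟩ := hD.internal_out x hx
    by_cases hwv : w = v
    · subst hwv
      obtain ⟨y, hy⟩ := hD.internal_out w hv
      exact ⟨y, mem_elim_E.2 (.inr ⟨hD.mem_inNbrs_iff.2 hw, hD.mem_outNbrs_iff.2 hy⟩)⟩
    · exact ⟨w, mem_elim_E.2 (.inl ⟨hw, hxv, hwv⟩)⟩

/-- Elimination of `v` shortcuts the paths through `v`; a path that ends in `v` survives up to its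
last edge. -/
theorem Reaches.elim {D : CompGraph V} (hD : D.IsCompDAG) {v a b : V} (ha : a ≠ v)
    (h : D.Reaches a b) :
    (b ≠ v → (D.elim v).Reaches a b) ∧
      (b = v → ∃ u, (u, v) ∈ D.E ∧ (u = a ∨ (D.elim v).Reaches a u)) := by
  induction h with
  | single h =>
    exact ⟨fun hb => .single (mem_elim_E.2 (.inl ⟨h, ha, hb⟩)), fun hb => ⟨a, hb ▸ h, .inl rfl⟩⟩
  | @tail b c _ hbc ih =>
    by_cases hb : b = v
    · subst hb
      refine ⟨fun _ => ?_, fun hc => absurd (hc ▸ hbc) (hD.not_loop b)⟩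
      obtain ⟨u, hu, hau⟩ := ih.2 rfl
      have huc : (u, c) ∈ (D.elim b).E :=
        mem_elim_E.2 (.inr ⟨hD.mem_inNbrs_iff.2 hu, hD.mem_outNbrs_iff.2 hbc⟩)
      rcases hau with rfl | hau
      · exact .single huc
      · exact hau.tail huc
    · exact ⟨fun hc => (ih.1 hb).tail (mem_elim_E.2 (.inl ⟨hbc, hb, hc⟩)),
        fun hc => ⟨b, hc ▸ hbc, .inr (ih.1 hb)⟩⟩

theorem cost_append (D : CompGraph V) (σ τ : List V) :
    D.cost (σ ++ τ) = D.cost σ + (D.elimSeq σ).cost τ := by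
  induction σ generalizing D with
  | nil => simp [cost, elimSeq]
  | cons v σ ih => simp [cost, elimSeq, ih, add_assoc]

theorem elimSeq_S (D : CompGraph V) (σ : List V) : (D.elimSeq σ).S = D.S := by
  induction σ generalizing D with
  | nil => rfl
  | cons v σ ih => exact ih _

theorem elimSeq_T (D : CompGraph V) (σ : List V) : (D.elimSeq σ).T = D.T := by
  induction σ generalizing D with
  | nil => rfl
  | cons v σ ih => exact ih _

theorem elimSeq_I (D : CompGraph V) (σ : List V) : (D.elimSeq σ).I = D.I \ σ.toFinset := by
  induction σ generalizing D with
  | nil => simp [elimSeq]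
  | cons v σ ih =>
    rw [elimSeq, ih]
    ext x
    simp only [elim, Finset.mem_sdiff, Finset.mem_erase, List.mem_toFinset, List.mem_cons]
    tauto

theorem elimSeq_verts_subset (D : CompGraph V) (σ : List V) : (D.elimSeq σ).verts ⊆ D.verts := by
  induction σ generalizing D with
  | nil => rfl
  | cons v σ ih => exact (ih _).trans (D.elim_verts_subset v)

theorem Reaches.elimSeq_le {D : CompGraph V} {σ : List V} {a b : V}
    (h : (D.elimSeq σ).Reaches a b) : D.Reaches a b := by
  induction σ generalizing D with
  | nil => exact h
  | cons v σ ih => exact (ih h).elim_le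

/-- Eliminating vertices that are not adjacent to `x` leaves the edges at `x` unchanged. -/
theorem mem_elimSeq_E_iff {D : CompGraph V} {ρ : List V} {x : V}
    (hx : ∀ v ∈ ρ, v ≠ x ∧ (x, v) ∉ D.E ∧ (v, x) ∉ D.E) (w : V) :
    ((x, w) ∈ (D.elimSeq ρ).E ↔ (x, w) ∈ D.E) ∧ ((w, x) ∈ (D.elimSeq ρ).E ↔ (w, x) ∈ D.E) := by
  induction ρ generalizing D with
  | nil => exact ⟨Iff.rfl, Iff.rfl⟩
  | cons v ρ ih =>
    obtain ⟨hvx, hxv, hvx'⟩ := hx v List.mem_cons_self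
    have key : ∀ w, ((x, w) ∈ (D.elim v).E ↔ (x, w) ∈ D.E) ∧
        ((w, x) ∈ (D.elim v).E ↔ (w, x) ∈ D.E) := by
      intro w
      constructor
      · rw [mem_elim_E, mem_inNbrs]
        constructor
        · rintro (h | h)
          · exact h.1
          · exact absurd h.1.2 hxv
        · exact fun h => .inl ⟨h, hvx.symm, fun hw => hxv (hw ▸ h)⟩
      · rw [mem_elim_E, mem_outNbrs]
        constructor
        · rintro (h | h)
          · exact h.1
          · exact absurd h.2.2 hvx'
        · exact fun h => .inl ⟨h, fun hw => hvx' (hw ▸ h), hvx.symm⟩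
    have := ih (D := D.elim v) fun u hu => by
      obtain ⟨h₁, h₂, h₃⟩ := hx u (List.mem_cons_of_mem _ hu)
      exact ⟨h₁, fun h => h₂ ((key u).1.1 h), fun h => h₃ ((key u).2.1 h)⟩
    exact ⟨this.1.trans (key w).1, this.2.trans (key w).2⟩

theorem IsTotalSeq.of_cons {D : CompGraph V} {v : V} {σ : List V} (h : D.IsTotalSeq (v :: σ)) :
    v ∈ D.I ∧ v ∉ σ ∧ (D.elim v).IsTotalSeq σ := by
  obtain ⟨hn, hI⟩ := h
  rw [List.nodup_cons] at hn
  refine ⟨hI ▸ by simp, hn.1, hn.2, ?_⟩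
  change _ = D.I.erase v
  rw [← hI, List.toFinset_cons, Finset.erase_insert (by simpa using hn.1)]

/-! ### Topological orders and paths to sinks -/

open Classical in
/-- The number of vertices that `v` reaches. It decreases along every edge. -/
noncomputable def numDescendants (D : CompGraph V) (v : V) : ℕ :=
  (D.verts.filter fun w => D.Reaches v w).card

theorem IsCompDAG.numDescendants_lt {D : CompGraph V} (hD : D.IsCompDAG) {u w : V}
    (h : D.Reaches u w) : D.numDescendants w < D.numDescendants u := by
  classical
  refine Finset.card_lt_card (Finset.ssubset_iff_of_subset ?_ |>.2 ⟨w, ?_, ?_⟩)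
  · intro x hx
    rw [Finset.mem_filter] at hx ⊢
    exact ⟨hx.1, h.trans hx.2⟩
  · obtain ⟨y, _, hy⟩ := Relation.TransGen.tail'_iff.1 h
    exact Finset.mem_filter.2 ⟨(hD.edge_mem _ _ hy).2, h⟩
  · exact fun hw => hD.acyclic w (Finset.mem_filter.1 hw).2

theorem IsCompDAG.exists_sink {D : CompGraph V} (hD : D.IsCompDAG) {v : V} (hv : v ∈ D.I) :
    ∃ t ∈ D.T, D.Reaches v t := by
  induction hn : D.numDescendants v using Nat.strong_induction_on generalizing v with
  | _ n ih =>
    obtain ⟨w, hw⟩ := hD.internal_out v hv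
    rcases mem_verts.1 (hD.edge_mem _ _ hw).2 with h | h | h
    · exact absurd hw (hD.source w h v)
    · obtain ⟨t, ht, hwt⟩ := ih _ (hn ▸ hD.numDescendants_lt (.single hw)) h rfl
      exact ⟨t, ht, .head hw hwt⟩
    · exact ⟨w, h, .single hw⟩

theorem IsCompDAG.exists_topological {D : CompGraph V} (hD : D.IsCompDAG) (A : Finset V) :
    ∃ σ : List V, σ.Nodup ∧ σ.toFinset = A ∧ σ.Pairwise fun a b => ¬ D.Reaches b a := by
  induction hn : A.card generalizing A with
  | zero => exact ⟨[], by simp [Finset.card_eq_zero.1 hn]⟩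
  | succ n ih =>
    obtain ⟨v, hv, hmax⟩ := A.exists_max_image D.numDescendants
      (Finset.card_pos.1 (by omega))
    obtain ⟨σ, h₁, h₂, h₃⟩ := ih (A.erase v) (by rw [Finset.card_erase_of_mem hv]; omega)
    have hmem : ∀ x, x ∈ σ ↔ x ≠ v ∧ x ∈ A := fun x => by
      rw [← List.mem_toFinset, h₂, Finset.mem_erase]
    refine ⟨v :: σ, List.nodup_cons.2 ⟨fun h => ((hmem v).1 h).1 rfl, h₁⟩, ?_,
      List.pairwise_cons.2 ⟨fun b hb h => ?_, h₃⟩⟩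
    · rw [List.toFinset_cons, h₂, Finset.insert_erase hv]
    · exact (hD.numDescendants_lt h).not_ge (hmax b ((hmem b).1 hb).2)

theorem IsCompDAG.exists_isFw {D : CompGraph V} (hD : D.IsCompDAG) (G : CompGraph V)
    (hG : ∀ a b, (a, b) ∈ G.E → D.Reaches a b) : ∃ σ, G.IsFw σ := by
  obtain ⟨σ, h₁, h₂, h₃⟩ := hD.exists_topological G.I
  exact ⟨σ, ⟨h₁, h₂⟩, h₃.imp fun h hE => h (hG _ _ hE)⟩

theorem IsCompDAG.exists_isRev {D : CompGraph V} (hD : D.IsCompDAG) (G : CompGraph V)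
    (hG : ∀ a b, (a, b) ∈ G.E → D.Reaches a b) : ∃ σ, G.IsRev σ := by
  obtain ⟨σ, h₁, h₂, h₃⟩ := hD.exists_topological G.I
  refine ⟨σ.reverse, ⟨List.nodup_reverse.2 h₁, by simpa using h₂⟩, List.pairwise_reverse.2 ?_⟩
  exact h₃.imp fun h hE => h (hG _ _ hE)

/-! ### Lower bounds on the optimum -/

/-- The edges with at least one internal end. -/
def incidentEdges (D : CompGraph V) : Finset (V × V) :=
  D.E.filter fun e => e.1 ∈ D.I ∨ e.2 ∈ D.I

theorem card_incidentEdges_le_cost {D : CompGraph V} (hD : D.IsCompDAG) {σ : List V}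
    (hσ : D.IsTotalSeq σ) : D.incidentEdges.card ≤ 2 * D.cost σ := by
  induction σ generalizing D with
  | nil =>
    have hI : D.I = ∅ := by simpa using hσ.2.symm
    simp [incidentEdges, hI]
  | cons v σ ih =>
    obtain ⟨hv, -, hσ'⟩ := hσ.of_cons
    have hsub : D.incidentEdges ⊆ (D.elim v).incidentEdges ∪
        ((D.inNbrs v).image (fun u => (u, v)) ∪ (D.outNbrs v).image fun w => (v, w)) := by
      rintro ⟨a, b⟩ he
      simp only [incidentEdges, Finset.mem_filter, Finset.mem_union, Finset.mem_image,
        Prod.mk.injEq, hD.mem_inNbrs_iff, hD.mem_outNbrs_iff, mem_elim_E] at he ⊢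
      by_cases ha : a = v
      · subst ha
        exact .inr (.inr ⟨b, he.1, rfl, rfl⟩)
      by_cases hb : b = v
      · subst hb
        exact .inr (.inl ⟨a, he.1, rfl, rfl⟩)
      refine .inl ⟨.inl ⟨he.1, ha, hb⟩, ?_⟩
      exact he.2.imp (fun h => Finset.mem_erase.2 ⟨ha, h⟩) fun h => Finset.mem_erase.2 ⟨hb, h⟩
    have hcard := (Finset.card_le_card hsub).trans (Finset.card_union_le _ _)
    have hcard' := Finset.card_union_le ((D.inNbrs v).image (fun u => (u, v)))
      ((D.outNbrs v).image fun w => (v, w))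
    have h₁ : ((D.inNbrs v).image (fun u => (u, v))).card ≤ _ := Finset.card_image_le
    have h₂ : ((D.outNbrs v).image (fun w => (v, w))).card ≤ _ := Finset.card_image_le
    obtain ⟨u, hu⟩ := hD.internal_in v hv
    obtain ⟨w, hw⟩ := hD.internal_out v hv
    have ha : 0 < (D.inNbrs v).card := Finset.card_pos.2 ⟨u, hD.mem_inNbrs_iff.2 hu⟩
    have hb : 0 < (D.outNbrs v).card := Finset.card_pos.2 ⟨w, hD.mem_outNbrs_iff.2 hw⟩
    have hm : (D.inNbrs v).card + (D.outNbrs v).card ≤ 2 * D.markowitz v := by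
      have h₃ := Nat.le_mul_of_pos_right (D.inNbrs v).card hb
      have h₄ := Nat.le_mul_of_pos_left (D.outNbrs v).card ha
      unfold markowitz
      omega
    have := ih (hD.elim hv) hσ'
    simp only [cost]
    omega

open Classical in
/-- The pairs of a source and a sink that are joined by a directed path with at least one internal
vertex. -/
noncomputable def throughPairs (D : CompGraph V) : Finset (V × V) :=
  (D.S ×ˢ D.T).filter fun p => ∃ v ∈ D.I, D.Reaches p.1 v ∧ D.Reaches v p.2

theorem mem_throughPairs {W : Type*} {D : CompGraph W} {s t : W} :
    (s, t) ∈ D.throughPairs ↔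
      (s ∈ D.S ∧ t ∈ D.T) ∧ ∃ v ∈ D.I, D.Reaches s v ∧ D.Reaches v t := by
  simp [throughPairs]

theorem throughPairs_subset_elim {D : CompGraph V} (hD : D.IsCompDAG) {v : V} (hv : v ∈ D.I) :
    D.throughPairs ⊆ (D.elim v).throughPairs ∪ D.inNbrs v ×ˢ D.outNbrs v := by
  rintro ⟨s, t⟩ h
  obtain ⟨⟨hs, ht⟩, x, hx, hsx, hxt⟩ := mem_throughPairs.1 h
  have hsv : s ≠ v := fun h => Finset.disjoint_left.1 hD.disjoint_S_I hs (h ▸ hv)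
  have htv : t ≠ v := fun h => Finset.disjoint_left.1 hD.disjoint_I_T hv (h ▸ ht)
  have survive : ∀ y ∈ D.I, y ≠ v → D.Reaches s y → D.Reaches y t →
      (s, t) ∈ (D.elim v).throughPairs ∪ D.inNbrs v ×ˢ D.outNbrs v := by
    intro y hy hyv hsy hyt
    exact Finset.mem_union_left _ (mem_throughPairs.2 ⟨⟨hs, ht⟩, y,
      Finset.mem_erase.2 ⟨hyv, hy⟩, (hsy.elim hD hsv).1 hyv, (hyt.elim hD hyv).1 htv⟩)
  by_cases hxv : x = v
  · subst hxv
    -- Unless the path is just `s, x, t`, it has another internal vertex next to `x`.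
    obtain ⟨u, hsu, hu⟩ := Relation.TransGen.tail'_iff.1 hsx
    obtain ⟨w, hw, hwt⟩ := Relation.TransGen.head'_iff.1 hxt
    rcases Relation.reflTransGen_iff_eq_or_transGen.1 hsu with rfl | hsu
    · rcases Relation.reflTransGen_iff_eq_or_transGen.1 hwt with rfl | hwt
      · exact Finset.mem_union_right _
          (Finset.mk_mem_product (hD.mem_inNbrs_iff.2 hu) (hD.mem_outNbrs_iff.2 hw))
      · have hsw := hsx.tail hw
        exact survive w (hD.mem_I_of_reaches hsw hwt) (fun h => hD.not_loop x (h ▸ hw)) hsw hwt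
    · have hut := Relation.TransGen.head hu hxt
      exact survive u (hD.mem_I_of_reaches hsu hut) (fun h => hD.not_loop x (h ▸ hu)) hsu hut
  · exact survive x hx hxv hsx hxt

theorem card_throughPairs_le_cost {D : CompGraph V} (hD : D.IsCompDAG) {σ : List V}
    (hσ : D.IsTotalSeq σ) : D.throughPairs.card ≤ D.cost σ := by
  induction σ generalizing D with
  | nil =>
    have hI : D.I = ∅ := by simpa using hσ.2.symm
    simp [throughPairs, hI]
  | cons v σ ih =>
    obtain ⟨hv, -, hσ'⟩ := hσ.of_cons
    have h := (Finset.card_le_card (throughPairs_subset_elim hD hv)).trans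
      (Finset.card_union_le _ _)
    rw [Finset.card_product] at h
    have := ih (hD.elim hv) hσ'
    simp only [cost, markowitz]
    omega

theorem card_incidentEdges_le {D : CompGraph V} (hD : D.IsCompDAG) :
    D.incidentEdges.card ≤ 2 * D.opt := by
  obtain ⟨σ, hσ, h⟩ := D.opt_isLeast.1
  exact h ▸ card_incidentEdges_le_cost hD hσ

theorem card_throughPairs_le {D : CompGraph V} (hD : D.IsCompDAG) :
    D.throughPairs.card ≤ D.opt := by
  obtain ⟨σ, hσ, h⟩ := D.opt_isLeast.1
  exact h ▸ card_throughPairs_le_cost hD hσ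

/-! ### The cost of forward and reverse orders of vertices outside the separator -/

/-- If no edge goes forward along `σ` and the out-neighbours of the vertices of `σ` lie in `σ` or
in `C`, then at the time of its elimination each vertex has all its out-neighbours in `C`, and no
more in-neighbours than it had originally. -/
theorem cost_le_of_reverse {G : CompGraph V} {C : Finset V} {σ : List V}
    (hrev : σ.Pairwise fun a b => (a, b) ∉ G.E) (hloop : ∀ v ∈ σ, (v, v) ∉ G.E)
    (hout : ∀ v ∈ σ, ∀ w, (v, w) ∈ G.E → w ∈ C ∨ w ∈ σ) :
    G.cost σ ≤ C.card * (σ.map fun v => (G.inNbrs v).card).sum := by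
  induction σ generalizing G with
  | nil => simp [cost]
  | cons v σ ih =>
    obtain ⟨hhead, htail⟩ := List.pairwise_cons.1 hrev
    have hvC : ∀ w, (v, w) ∈ G.E → w ∈ C := by
      intro w hw
      rcases hout v List.mem_cons_self w hw with h | h
      · exact h
      · rcases List.mem_cons.1 h with rfl | h
        · exact absurd hw (hloop w List.mem_cons_self)
        · exact absurd hw (hhead w h)
    have hnew : ∀ a, ∀ b ∈ σ, (a, b) ∈ (G.elim v).E → (a, b) ∈ G.E := by
      intro a b hb hab
      rcases mem_elim_E.1 hab with h | h
      · exact h.1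
      · exact absurd (mem_outNbrs.1 h.2).2 (hhead b hb)
    have hv : G.markowitz v ≤ C.card * (G.inNbrs v).card := by
      rw [markowitz, mul_comm]
      exact Nat.mul_le_mul_right _
        (Finset.card_le_card fun w hw => hvC w (mem_outNbrs.1 hw).2)
    have hin : (σ.map fun x => ((G.elim v).inNbrs x).card).sum ≤
        (σ.map fun x => (G.inNbrs x).card).sum := by
      refine List.sum_le_sum fun x hx => Finset.card_le_card fun u hu => ?_
      rw [mem_inNbrs] at hu ⊢
      exact ⟨G.elim_verts_subset v hu.1, hnew u x hx hu.2⟩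
    have hrec := ih (G := G.elim v)
      (htail.imp_of_mem fun _ hb hab h => hab (hnew _ _ hb h))
      (fun x hx h => hloop x (List.mem_cons_of_mem _ hx) (hnew x x hx h))
      (fun x hx w hw => by
        rcases mem_elim_E.1 hw with ⟨hw, _, hwv⟩ | ⟨_, hw⟩
        · refine (hout x (List.mem_cons_of_mem _ hx) w hw).imp_right fun h => ?_
          exact (List.mem_cons.1 h).resolve_left hwv
        · exact .inl (hvC w (mem_outNbrs.1 hw).2))
    rw [List.map_cons, List.sum_cons, mul_add]
    exact add_le_add hv (hrec.trans (Nat.mul_le_mul_left _ hin))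

/-- The graph with all edges reversed. -/
def reverse (D : CompGraph V) : CompGraph V where
  S := D.T
  I := D.I
  T := D.S
  E := D.E.image Prod.swap

theorem mem_reverse_E {D : CompGraph V} {a b : V} : (a, b) ∈ D.reverse.E ↔ (b, a) ∈ D.E := by
  simp [reverse]

theorem reverse_verts (D : CompGraph V) : D.reverse.verts = D.verts := by
  ext x
  simp only [mem_verts, reverse]
  tauto

theorem reverse_inNbrs (D : CompGraph V) (v : V) : D.reverse.inNbrs v = D.outNbrs v := by
  ext u
  rw [mem_inNbrs, mem_outNbrs, reverse_verts, mem_reverse_E]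

theorem reverse_outNbrs (D : CompGraph V) (v : V) : D.reverse.outNbrs v = D.inNbrs v := by
  ext u
  rw [mem_inNbrs, mem_outNbrs, reverse_verts, mem_reverse_E]

theorem reverse_elim (D : CompGraph V) (v : V) : D.reverse.elim v = (D.elim v).reverse := by
  ext e
  · rfl
  · rfl
  · rfl
  · obtain ⟨a, b⟩ := e
    rw [mem_reverse_E, mem_elim_E, mem_elim_E, mem_reverse_E, reverse_inNbrs, reverse_outNbrs]
    tauto

theorem reverse_cost (D : CompGraph V) (σ : List V) : D.reverse.cost σ = D.cost σ := by
  induction σ generalizing D with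
  | nil => rfl
  | cons v σ ih =>
    simp only [cost, markowitz, reverse_elim, ih, reverse_inNbrs, reverse_outNbrs, mul_comm]

theorem cost_le_of_forward {G : CompGraph V} {C : Finset V} {σ : List V}
    (hfw : σ.Pairwise fun a b => (b, a) ∉ G.E) (hloop : ∀ v ∈ σ, (v, v) ∉ G.E)
    (hin : ∀ v ∈ σ, ∀ u, (u, v) ∈ G.E → u ∈ C ∨ u ∈ σ) :
    G.cost σ ≤ C.card * (σ.map fun v => (G.outNbrs v).card).sum := by
  have := cost_le_of_reverse (G := G.reverse) (C := C) (σ := σ)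
    (hfw.imp fun h => by rwa [mem_reverse_E]) (fun v hv => by rw [mem_reverse_E]; exact hloop v hv)
    (fun v hv w hw => hin v hv w (mem_reverse_E.1 hw))
  simpa only [reverse_cost, reverse_inNbrs] using this

/-- The bound for forward orders also holds, with the original out-degrees, after vertices
not adjacent to those of `σ` have been eliminated. -/
theorem cost_elimSeq_le_of_forward {D : CompGraph V} {C : Finset V} {ρ σ : List V}
    (hρ : ∀ x ∈ σ, ∀ v ∈ ρ, v ≠ x ∧ (x, v) ∉ D.E ∧ (v, x) ∉ D.E)
    (hfw : σ.Pairwise fun a b => (b, a) ∉ D.E) (hloop : ∀ v ∈ σ, (v, v) ∉ D.E)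
    (hin : ∀ v ∈ σ, ∀ u, (u, v) ∈ D.E → u ∈ C ∨ u ∈ σ) :
    (D.elimSeq ρ).cost σ ≤ C.card * (σ.map fun v => (D.outNbrs v).card).sum := by
  have hE : ∀ x ∈ σ, ∀ w, ((x, w) ∈ (D.elimSeq ρ).E ↔ (x, w) ∈ D.E) ∧
      ((w, x) ∈ (D.elimSeq ρ).E ↔ (w, x) ∈ D.E) := fun x hx => mem_elimSeq_E_iff (hρ x hx)
  refine (cost_le_of_forward (C := C)
    (hfw.imp_of_mem fun {a _} ha _ h hE' => h (((hE a ha _).2).1 hE'))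
    (fun v hv h => hloop v hv ((hE v hv v).1.1 h))
    (fun v hv u hu => hin v hv u ((hE v hv u).2.1 hu))).trans ?_
  refine Nat.mul_le_mul_left _ (List.sum_le_sum fun x hx => Finset.card_le_card fun u hu => ?_)
  rw [mem_outNbrs] at hu ⊢
  exact ⟨D.elimSeq_verts_subset ρ hu.1, (hE x hx u).1.1 hu.2⟩

theorem sum_card_inNbrs_le (D : CompGraph V) {σ : List V} (hσ : σ.Nodup) :
    (σ.map fun v => (D.inNbrs v).card).sum ≤ (D.E.filter fun e => e.2 ∈ σ).card := by
  rw [← List.sum_toFinset _ hσ,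
    Finset.card_eq_sum_card_fiberwise (f := Prod.snd) (t := σ.toFinset)
      (fun e he => by simpa using (Finset.mem_filter.1 he).2)]
  refine Finset.sum_le_sum fun v hv => ?_
  refine Finset.card_le_card_of_injOn (fun u => (u, v)) (fun u hu => ?_)
    (fun a _ b _ h => (Prod.mk.inj h).1)
  simpa using ⟨(mem_inNbrs.1 hu).2, by simpa using hv⟩

theorem sum_card_outNbrs_le (D : CompGraph V) {σ : List V} (hσ : σ.Nodup) :
    (σ.map fun v => (D.outNbrs v).card).sum ≤ (D.E.filter fun e => e.1 ∈ σ).card := by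
  rw [← List.sum_toFinset _ hσ,
    Finset.card_eq_sum_card_fiberwise (f := Prod.fst) (t := σ.toFinset)
      (fun e he => by simpa using (Finset.mem_filter.1 he).2)]
  refine Finset.sum_le_sum fun v hv => ?_
  refine Finset.card_le_card_of_injOn (fun u => (v, u)) (fun u hu => ?_)
    (fun a _ b _ h => (Prod.mk.inj h).2)
  simpa using ⟨(mem_outNbrs.1 hu).2, by simpa using hv⟩

/-! ### The cost of the final forward phase -/

theorem two_mul_cost_le_of_isFw {D : CompGraph V} (hD : D.IsCompDAG) {G : CompGraph V}
    (hS : G.S = D.S) (hT : G.T = D.T) (hI : G.I ⊆ D.I)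
    (hE : ∀ a b, (a, b) ∈ G.E → D.Reaches a b) {σ : List V} (hσ : G.IsFw σ) :
    2 * G.cost σ ≤ D.throughPairs.card * (σ.length * (σ.length + 1)) := by
  induction σ generalizing G with
  | nil => simp [cost]
  | cons v σ ih =>
    obtain ⟨htot, hfw⟩ := hσ
    obtain ⟨hvI, -, htot'⟩ := htot.of_cons
    obtain ⟨hhead, htail⟩ := List.pairwise_cons.1 hfw
    have hmem : ∀ x ∈ G.I, x = v ∨ x ∈ σ := fun x hx => by
      simpa using (htot.2 ▸ hx : x ∈ (v :: σ).toFinset)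
    have hin : ∀ u ∈ G.inNbrs v, u ∈ D.S := by
      intro u hu
      obtain ⟨hu, huv⟩ := mem_inNbrs.1 hu
      rcases mem_verts.1 hu with h | h | h
      · exact hS ▸ h
      · rcases hmem u h with rfl | h
        · exact absurd (hE _ _ huv) (hD.acyclic u)
        · exact absurd huv (hhead u h)
      · obtain ⟨x, hx, _⟩ := Relation.TransGen.head'_iff.1 (hE _ _ huv)
        exact absurd hx (hD.sink u (hT ▸ h) x)
    have hout : G.outNbrs v ⊆ ((G.outNbrs v).filter (· ∈ D.T)) ∪ σ.toFinset := by
      intro w hw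
      obtain ⟨hw', hvw⟩ := mem_outNbrs.1 hw
      rw [Finset.mem_union, Finset.mem_filter, List.mem_toFinset]
      rcases mem_verts.1 hw' with h | h | h
      · obtain ⟨x, _, hx⟩ := Relation.TransGen.tail'_iff.1 (hE _ _ hvw)
        exact absurd hx (hD.source w (hS ▸ h) x)
      · rcases hmem w h with rfl | h
        · exact absurd (hE _ _ hvw) (hD.acyclic w)
        · exact .inr h
      · exact .inl ⟨hw, hT ▸ h⟩
    -- The pairs of an in-neighbour and a sink among the out-neighbours are through pairs.
    have hprod : (G.inNbrs v).card * ((G.outNbrs v).filter (· ∈ D.T)).card ≤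
        D.throughPairs.card := by
      rw [← Finset.card_product]
      refine Finset.card_le_card ?_
      rintro ⟨s, t⟩ hst
      obtain ⟨hs, ht⟩ := Finset.mem_product.1 hst
      obtain ⟨ht, htT⟩ := Finset.mem_filter.1 ht
      exact mem_throughPairs.2 ⟨⟨hin s hs, htT⟩, v, hI hvI, hE _ _ (mem_inNbrs.1 hs).2,
        hE _ _ (mem_outNbrs.1 ht).2⟩
    have hone : (G.inNbrs v).card ≤ D.throughPairs.card := by
      obtain ⟨t, ht, hvt⟩ := hD.exists_sink (hI hvI)
      refine Finset.card_le_card_of_injOn (fun s => (s, t)) (fun s hs => ?_)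
        (fun a _ b _ h => (Prod.mk.inj h).1)
      exact mem_throughPairs.2 ⟨⟨hin s hs, ht⟩, v, hI hvI, hE _ _ (mem_inNbrs.1 hs).2, hvt⟩
    have hb : (G.outNbrs v).card ≤ ((G.outNbrs v).filter (· ∈ D.T)).card + σ.length :=
      ((Finset.card_le_card hout).trans (Finset.card_union_le _ _)).trans
        (Nat.add_le_add_left (List.toFinset_card_le _) _)
    have hmark : G.markowitz v ≤ D.throughPairs.card * (1 + σ.length) := by
      calc G.markowitz v
          ≤ (G.inNbrs v).card * (((G.outNbrs v).filter (· ∈ D.T)).card + σ.length) :=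
            Nat.mul_le_mul_left _ hb
        _ ≤ D.throughPairs.card + D.throughPairs.card * σ.length := by
            rw [mul_add]
            exact add_le_add hprod (Nat.mul_le_mul_right _ hone)
        _ = _ := by ring
    have hrec := ih (G := G.elim v) hS hT ((Finset.erase_subset _ _).trans hI)
      (fun a b hab => by
        rcases mem_elim_E.1 hab with h | ⟨ha, hb⟩
        · exact hE _ _ h.1
        · exact (hE _ _ (mem_inNbrs.1 ha).2).trans (hE _ _ (mem_outNbrs.1 hb).2))
      ⟨htot', htail.imp_of_mem fun {a b} _ hb hab h => by
        rcases mem_elim_E.1 h with h | h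
        · exact hab h.1
        · exact hhead b hb (mem_inNbrs.1 h.1).2⟩
    simp only [cost, List.length_cons]
    calc 2 * (G.markowitz v + (G.elim v).cost σ)
        = 2 * G.markowitz v + 2 * (G.elim v).cost σ := by ring
      _ ≤ 2 * (D.throughPairs.card * (1 + σ.length)) +
          D.throughPairs.card * (σ.length * (σ.length + 1)) :=
        add_le_add (Nat.mul_le_mul_left _ hmark) hrec
      _ = _ := by ring

/-! ### Components outside a separator -/

theorem mem_reach {D : CompGraph V} {C A : Finset V} {x : V} :
    x ∈ D.reach C A ↔ (x ∈ D.verts ∧ x ∉ C) ∧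
      ∃ a, (a ∈ A ∧ a ∉ C) ∧ (D.delete C).undirected.Reachable a x := by
  have : x ∈ (D.delete C).verts ↔ x ∈ D.verts ∧ x ∉ C := by
    simp only [mem_verts, delete, Finset.mem_sdiff]
    tauto
  simp only [reach, Finset.mem_filter, this, Finset.mem_sdiff]

theorem IsCompDAG.reachable_of_edge {D : CompGraph V} (hD : D.IsCompDAG) {C : Finset V} {x y : V}
    (hx : x ∉ C) (hy : y ∉ C) (h : (x, y) ∈ D.E ∨ (y, x) ∈ D.E) :
    (D.delete C).undirected.Reachable x y := by
  refine SimpleGraph.Adj.reachable ((SimpleGraph.fromRel_adj _ _ _).2 ⟨?_, ?_⟩)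
  · rintro rfl
    exact hD.not_loop x (h.elim id id)
  · simp only [delete, Finset.mem_filter]
    tauto

theorem IsCompDAG.mem_reach_of_edge {D : CompGraph V} (hD : D.IsCompDAG) {C A : Finset V} {x y : V}
    (hx : x ∈ D.reach C A) (hy : y ∉ C) (h : (x, y) ∈ D.E ∨ (y, x) ∈ D.E) :
    y ∈ D.reach C A := by
  obtain ⟨⟨_, hxC⟩, a, ha, hax⟩ := mem_reach.1 hx
  exact mem_reach.2 ⟨⟨h.elim (fun h => (hD.edge_mem _ _ h).2) fun h => (hD.edge_mem _ _ h).1, hy⟩,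
    a, ha, hax.trans (hD.reachable_of_edge hxC hy h)⟩

theorem delete_undirected_le (D : CompGraph V) (C : Finset V) :
    (D.delete C).undirected ≤ D.undirected := by
  intro a b h
  obtain ⟨hne, h⟩ := (SimpleGraph.fromRel_adj _ _ _).1 h
  exact (SimpleGraph.fromRel_adj _ _ _).2
    ⟨hne, h.imp (fun h => (Finset.mem_filter.1 h).1) fun h => (Finset.mem_filter.1 h).1⟩

theorem not_mem_of_mem_support {D : CompGraph V} {C : Finset V} {a b : V}
    (p : (D.delete C).undirected.Walk a b) (ha : a ∉ C) : ∀ x ∈ p.support, x ∉ C := by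
  induction p with
  | nil => simpa using ha
  | cons h p ih =>
    intro x hx
    rw [SimpleGraph.Walk.support_cons, List.mem_cons] at hx
    rcases hx with rfl | hx
    · exact ha
    · refine ih ?_ x hx
      have h' := ((SimpleGraph.fromRel_adj _ _ _).1 h).2
      simp only [delete, Finset.mem_filter] at h'
      tauto

theorem IsSeparator.not_reachable {D : CompGraph V} {C : Finset V} (hC : D.IsSeparator C) {s t : V}
    (hs : s ∈ D.S) (ht : t ∈ D.T) (hsC : s ∉ C) :
    ¬ (D.delete C).undirected.Reachable s t := by
  classical
  rintro ⟨p⟩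
  obtain ⟨c, hc, hcp⟩ := hC.2 s hs t ht (p.bypass.mapLe (D.delete_undirected_le C))
    ((SimpleGraph.Walk.isPath_mapLe _).2 p.bypass_isPath)
  rw [SimpleGraph.Walk.support_mapLe_eq_support] at hcp
  exact not_mem_of_mem_support _ hsC c hcp hc

theorem IsSeparator.not_mem_right {D : CompGraph V} {C : Finset V} (hC : D.IsSeparator C) {x : V}
    (hx : x ∈ D.leftVerts C) : x ∉ D.rightVerts C := by
  intro hx'
  obtain ⟨_, s, hs, hsx⟩ := mem_reach.1 hx
  obtain ⟨_, t, ht, htx⟩ := mem_reach.1 hx'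
  exact hC.not_reachable hs.1 ht.1 hs.2 (hsx.trans htx.symm)

theorem mem_leftVerts_of_mem_S {D : CompGraph V} {C : Finset V} {x : V} (hx : x ∈ D.S)
    (hxC : x ∉ C) : x ∈ D.leftVerts C :=
  mem_reach.2 ⟨⟨mem_verts.2 (.inl hx), hxC⟩, x, ⟨hx, hxC⟩, .refl _⟩

theorem mem_rightVerts_of_mem_T {D : CompGraph V} {C : Finset V} {x : V} (hx : x ∈ D.T)
    (hxC : x ∉ C) : x ∈ D.rightVerts C :=
  mem_reach.2 ⟨⟨mem_verts.2 (.inr (.inr hx)), hxC⟩, x, ⟨hx, hxC⟩, .refl _⟩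

theorem mem_reach_of_mem {D : CompGraph V} {C A : Finset V} {v x : V}
    (hx : x ∈ D.reach C {v}) (hx' : x ∈ D.reach C A) (hv : v ∈ D.verts) : v ∈ D.reach C A := by
  obtain ⟨_, a, ⟨ha, haC⟩, hax⟩ := mem_reach.1 hx
  obtain rfl := Finset.mem_singleton.1 ha
  obtain ⟨_, b, hb, hbx⟩ := mem_reach.1 hx'
  exact mem_reach.2 ⟨⟨hv, haC⟩, b, hb, hbx.trans hax.symm⟩

/-- The vertices outside `C ∪ V^L ∪ V^R` are those of the middle components. -/
theorem exists_mem_middleParts_iff {D : CompGraph V} {C : Finset V} {x : V} :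
    (∃ W ∈ D.middleParts C, x ∈ W) ↔
      x ∈ D.verts ∧ x ∉ C ∧ x ∉ D.leftVerts C ∧ x ∉ D.rightVerts C := by
  constructor
  · rintro ⟨W, hW, hx⟩
    obtain ⟨v, hv, rfl⟩ := Finset.mem_image.1 hW
    simp only [Finset.mem_sdiff, Finset.mem_union, not_or] at hv
    obtain ⟨hv, ⟨hvC, hvL⟩, hvR⟩ := hv
    exact ⟨(mem_reach.1 hx).1.1, (mem_reach.1 hx).1.2,
      fun h => hvL (mem_reach_of_mem hx h hv), fun h => hvR (mem_reach_of_mem hx h hv)⟩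
  · rintro ⟨hx, hxC, hxL, hxR⟩
    refine ⟨D.reach C {x}, Finset.mem_image_of_mem _ ?_,
      mem_reach.2 ⟨⟨hx, hxC⟩, x, ⟨Finset.mem_singleton_self x, hxC⟩, .refl _⟩⟩
    simp only [Finset.mem_sdiff, Finset.mem_union]
    tauto

theorem eq_of_mem_middleParts {D : CompGraph V} {C W W' : Finset V} {x : V}
    (hW : W ∈ D.middleParts C) (hW' : W' ∈ D.middleParts C) (hx : x ∈ W) (hx' : x ∈ W') :
    W = W' := by
  obtain ⟨v, -, rfl⟩ := Finset.mem_image.1 hW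
  obtain ⟨v', -, rfl⟩ := Finset.mem_image.1 hW'
  obtain ⟨_, a, ⟨ha, haC⟩, hax⟩ := mem_reach.1 hx
  obtain ⟨_, a', ⟨ha', haC'⟩, hax'⟩ := mem_reach.1 hx'
  obtain rfl := Finset.mem_singleton.1 ha
  obtain rfl := Finset.mem_singleton.1 ha'
  ext y
  simp only [mem_reach, Finset.mem_singleton]
  constructor
  · rintro ⟨hy, _, ⟨rfl, _⟩, h⟩
    exact ⟨hy, a', ⟨rfl, haC'⟩, hax'.trans (hax.symm.trans h)⟩
  · rintro ⟨hy, _, ⟨rfl, _⟩, h⟩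
    exact ⟨hy, a, ⟨rfl, haC⟩, hax.trans (hax'.symm.trans h)⟩

theorem IsCompDAG.mem_middlePart_of_edge {D : CompGraph V} (hD : D.IsCompDAG) {C W : Finset V}
    {x y : V} (hW : W ∈ D.middleParts C) (hx : x ∈ W) (hy : y ∉ C)
    (h : (x, y) ∈ D.E ∨ (y, x) ∈ D.E) : y ∈ W := by
  obtain ⟨v, -, rfl⟩ := Finset.mem_image.1 hW
  exact hD.mem_reach_of_edge hx hy h

theorem mem_pieceEdges {D : CompGraph V} {C W : Finset V} {a b : V} (ha : a ∈ W) (hb : b ∈ W)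
    (haC : a ∉ C) (h : (a, b) ∈ D.E) : (a, b) ∈ D.pieceEdges C W := by
  simp [pieceEdges, ha, hb, haC, h]

/-! ### Analysis of the algorithm -/

theorem mem_flatten_middle_iff {D : CompGraph V} {C : Finset V} {parts : List (Finset V)}
    {σM : List (List V)}
    (h : List.Forall₂ (fun W τ => (D.middleGraph C W).IsFw τ) parts σM) {x : V} :
    x ∈ σM.flatten ↔ x ∈ D.I ∧ ∃ W ∈ parts, x ∈ W := by
  induction h with
  | nil => simp
  | @cons W τ parts σM hW _ ih =>
    have : x ∈ τ ↔ x ∈ D.I ∧ x ∈ W := by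
      rw [← List.mem_toFinset, hW.1.2]
      exact Finset.mem_inter
    rw [List.flatten_cons, List.mem_append, this, ih]
    simp only [List.mem_cons, exists_eq_or_imp]
    tauto

/-- Forward orders of the middle components concatenate to a forward order. -/
theorem pairwise_flatten_middle {D : CompGraph V} (hD : D.IsCompDAG) {C : Finset V}
    {parts : List (Finset V)} {σM : List (List V)} (hn : parts.Nodup)
    (hparts : ∀ W ∈ parts, W ∈ D.middleParts C)
    (h : List.Forall₂ (fun W τ => (D.middleGraph C W).IsFw τ) parts σM) :
    σM.flatten.Pairwise fun a b => a ≠ b ∧ (b, a) ∉ D.E := by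
  induction h with
  | nil => simp
  | @cons W τ parts σM hW hrest ih =>
    obtain ⟨hWn, hn⟩ := List.nodup_cons.1 hn
    have hWm := hparts W List.mem_cons_self
    have hτ : ∀ x ∈ τ, x ∈ W := fun x hx => by
      rw [← List.mem_toFinset, hW.1.2] at hx
      exact (Finset.mem_inter.1 hx).2
    have hC : ∀ x, ∀ W' ∈ D.middleParts C, x ∈ W' → x ∉ C := fun x W' hW' hx =>
      (exists_mem_middleParts_iff.1 ⟨W', hW', hx⟩).2.1
    rw [List.flatten_cons, List.pairwise_append]
    refine ⟨?_, ih hn fun W' hW' => hparts W' (List.mem_cons_of_mem _ hW'), ?_⟩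
    · refine (hW.1.1.and hW.2).imp_of_mem fun {a b} ha hb hab => ⟨hab.1, fun h => hab.2 ?_⟩
      exact mem_pieceEdges (hτ b hb) (hτ a ha) (hC b W hWm (hτ b hb)) h
    · intro a ha b hb
      obtain ⟨_, W', hW', hbW'⟩ := (mem_flatten_middle_iff hrest).1 hb
      have hW'm := hparts W' (List.mem_cons_of_mem _ hW')
      have hbW : b ∉ W := fun hbW => hWn (eq_of_mem_middleParts hWm hW'm hbW hbW' ▸ hW')
      refine ⟨fun h => hbW (h ▸ hτ a ha), fun h => hbW ?_⟩
      exact hD.mem_middlePart_of_edge hWm (hτ a ha) (hC b W' hW'm hbW') (.inr h)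

theorem exists_isMiddleOut {D : CompGraph V} (hD : D.IsCompDAG) (C : Finset V) :
    ∃ σ, D.IsMiddleOut C σ := by
  obtain ⟨σL, hL⟩ := hD.exists_isRev (D.leftGraph C) fun a b h =>
    .single (Finset.mem_filter.1 (Finset.mem_filter.1 h).1).1
  obtain ⟨σR, hR⟩ := hD.exists_isFw (D.rightGraph C) fun a b h =>
    .single (Finset.mem_filter.1 (Finset.mem_filter.1 h).1).1
  have hM : ∀ W, ∃ τ, (D.middleGraph C W).IsFw τ := fun W =>
    hD.exists_isFw (D.middleGraph C W) fun a b h => .single (Finset.mem_filter.1 h).1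
  choose τ hτ using hM
  obtain ⟨σC, hσC⟩ := hD.exists_isFw
    (D.elimSeq (σL ++ σR ++ ((D.middleParts C).toList.map τ).flatten))
    fun a b h => Reaches.elimSeq_le (.single h)
  refine ⟨_, σL, σR, (D.middleParts C).toList, (D.middleParts C).toList.map τ, σC, hL, hR,
    Finset.nodup_toList _, Finset.toList_toFinset _, ?_, hσC, rfl⟩
  exact List.forall₂_map_right_iff.2 (List.forall₂_same.2 fun W _ => hτ W)

theorem IsMiddleOut.isTotalSeq_and_cost_le {D : CompGraph V} (hD : D.IsCompDAG) {C : Finset V}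
    (hC : D.IsSeparator C) {σ : List V} (h : D.IsMiddleOut C σ) :
    D.IsTotalSeq σ ∧ 2 * D.cost σ ≤ (C.card ^ 2 + 5 * C.card) * D.opt := by
  obtain ⟨σL, σR, parts, σM, σC, hL, hR, hparts, hpartsM, hM, hσC, rfl⟩ := h
  have hmemL : ∀ x, x ∈ σL ↔ x ∈ D.I ∧ x ∈ D.leftVerts C := fun x => by
    rw [← List.mem_toFinset, hL.1.2]
    exact Finset.mem_inter
  have hmemR : ∀ x, x ∈ σR ↔ x ∈ D.I ∧ x ∈ D.rightVerts C := fun x => by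
    rw [← List.mem_toFinset, hR.1.2]
    exact Finset.mem_inter
  have hpartsM' : ∀ W, W ∈ parts ↔ W ∈ D.middleParts C := fun W => by
    rw [← List.mem_toFinset, hpartsM]
  have hmemM : ∀ x, x ∈ σM.flatten ↔
      x ∈ D.I ∧ x ∉ C ∧ x ∉ D.leftVerts C ∧ x ∉ D.rightVerts C := fun x => by
    rw [mem_flatten_middle_iff hM]
    simp only [hpartsM', exists_mem_middleParts_iff, mem_verts]
    tauto
  have hLC : ∀ x ∈ D.leftVerts C, x ∉ C := fun x hx => (mem_reach.1 hx).1.2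
  have hRC : ∀ x ∈ D.rightVerts C, x ∉ C := fun x hx => (mem_reach.1 hx).1.2
  have hLR : ∀ x ∈ D.leftVerts C, x ∉ D.rightVerts C := fun x hx => hC.not_mem_right hx
  have hmemRM : ∀ x, x ∈ σR ++ σM.flatten ↔ x ∈ D.I ∧ x ∉ C ∧ x ∉ D.leftVerts C := fun x => by
    rw [List.mem_append, hmemR, hmemM]
    have := hRC x
    have := hLR x
    tauto
  -- The right and the middle parts together behave like a single forward order.
  have hRM : (σR ++ σM.flatten).Pairwise fun a b => a ≠ b ∧ (b, a) ∉ D.E := by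
    rw [List.pairwise_append]
    refine ⟨?_, pairwise_flatten_middle hD hparts (fun W hW => (hpartsM' W).1 hW) hM, ?_⟩
    · refine (hR.1.1.and hR.2).imp_of_mem fun {a b} ha hb hab => ⟨hab.1, fun h => hab.2 ?_⟩
      have ha' := ((hmemR a).1 ha).2
      have hb' := ((hmemR b).1 hb).2
      exact Finset.mem_filter.2
        ⟨mem_pieceEdges hb' ha' (hRC b hb') h, fun h => hRC b hb' h.1⟩
    · intro a ha b hb
      obtain ⟨_, hbC, _, hbR⟩ := (hmemM b).1 hb
      have ha' := ((hmemR a).1 ha).2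
      exact ⟨fun h => hbR (h ▸ ha'), fun h => hbR (hD.mem_reach_of_edge ha' hbC (.inr h))⟩
  have hnRM : (σR ++ σM.flatten).Nodup := hRM.imp And.left
  have hsep : ∀ x ∈ σR ++ σM.flatten, ∀ v ∈ σL, v ≠ x ∧ (x, v) ∉ D.E ∧ (v, x) ∉ D.E := by
    intro x hx v hv
    obtain ⟨_, hxC, hxL⟩ := (hmemRM x).1 hx
    have hv' := ((hmemL v).1 hv).2
    exact ⟨fun h => hxL (h ▸ hv'), fun h => hxL (hD.mem_reach_of_edge hv' hxC (.inr h)),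
      fun h => hxL (hD.mem_reach_of_edge hv' hxC (.inl h))⟩
  rw [List.append_assoc σL] at hσC ⊢
  have hnpre : (σL ++ (σR ++ σM.flatten)).Nodup :=
    List.nodup_append.2 ⟨hL.1.1, hnRM, fun a ha b hb => (hsep b hb a ha).1⟩
  have hmemC : ∀ x, x ∈ σC ↔ x ∈ D.I ∧ x ∈ C := fun x => by
    rw [← List.mem_toFinset, hσC.1.2, elimSeq_I, Finset.mem_sdiff, List.mem_toFinset,
      List.mem_append, hmemL, hmemRM]
    have := hLC x
    tauto
  refine ⟨⟨List.nodup_append.2 ⟨hnpre, hσC.1.1, ?_⟩, ?_⟩, ?_⟩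
  · rintro a ha _ hb rfl
    have := ((hmemC a).1 hb).2
    rw [List.mem_append, hmemL, hmemRM] at ha
    have := hLC a
    tauto
  · ext x
    rw [List.mem_toFinset, List.mem_append, List.mem_append, hmemL, hmemRM, hmemC]
    tauto
  have hcostL : D.cost σL ≤ C.card * (σL.map fun v => (D.inNbrs v).card).sum := by
    refine cost_le_of_reverse ?_ (fun v _ => hD.not_loop v) ?_
    · refine hL.2.imp_of_mem fun {a b} ha hb hab h => hab ?_
      have ha' := ((hmemL a).1 ha).2
      have hb' := ((hmemL b).1 hb).2
      exact Finset.mem_filter.2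
        ⟨mem_pieceEdges ha' hb' (hLC a ha') h, fun h => hLC b hb' h.2⟩
    · intro v hv w hw
      by_cases hwC : w ∈ C
      · exact .inl hwC
      have hw' := hD.mem_reach_of_edge ((hmemL v).1 hv).2 hwC (.inl hw)
      refine .inr ((hmemL w).2 ⟨?_, hw'⟩)
      rcases mem_verts.1 (hD.edge_mem _ _ hw).2 with h | h | h
      · exact absurd hw (hD.source w h v)
      · exact h
      · exact absurd (mem_rightVerts_of_mem_T h hwC) (hLR w hw')
  have hcostRM : (D.elimSeq σL).cost (σR ++ σM.flatten) ≤
      C.card * ((σR ++ σM.flatten).map fun v => (D.outNbrs v).card).sum := by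
    refine cost_elimSeq_le_of_forward hsep (hRM.imp And.right) (fun v _ => hD.not_loop v) ?_
    intro v hv u hu
    by_cases huC : u ∈ C
    · exact .inl huC
    obtain ⟨_, hvC, hvL⟩ := (hmemRM v).1 hv
    have huL : u ∉ D.leftVerts C := fun h => hvL (hD.mem_reach_of_edge h hvC (.inl hu))
    refine .inr ((hmemRM u).2 ⟨?_, huC, huL⟩)
    rcases mem_verts.1 (hD.edge_mem _ _ hu).1 with h | h | h
    · exact absurd (mem_leftVerts_of_mem_S h huC) huL
    · exact h
    · exact absurd hu (hD.sink u h v)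
  -- No edge enters the left part from a right or middle part, so each edge is counted once.
  have hcount : (σL.map fun v => (D.inNbrs v).card).sum +
      ((σR ++ σM.flatten).map fun v => (D.outNbrs v).card).sum ≤ D.incidentEdges.card := by
    refine (add_le_add (D.sum_card_inNbrs_le hL.1.1) (D.sum_card_outNbrs_le hnRM)).trans ?_
    rw [← Finset.card_union_of_disjoint]
    · refine Finset.card_le_card (Finset.union_subset ?_ ?_) <;> intro e he <;>
        obtain ⟨he, h⟩ := Finset.mem_filter.1 he
      · exact Finset.mem_filter.2 ⟨he, .inr ((hmemL _).1 h).1⟩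
      · exact Finset.mem_filter.2 ⟨he, .inl ((hmemRM _).1 h).1⟩
    · rw [Finset.disjoint_left]
      rintro ⟨a, b⟩ he he'
      obtain ⟨he, hb⟩ := Finset.mem_filter.1 he
      exact (hsep a (Finset.mem_filter.1 he').2 b hb).2.1 he
  have hcostC := two_mul_cost_le_of_isFw hD (D.elimSeq_S _) (D.elimSeq_T _)
    (by rw [elimSeq_I]; exact Finset.sdiff_subset)
    (fun a b h => Reaches.elimSeq_le (.single h)) hσC
  have hlen : σC.length ≤ C.card := by
    rw [← List.toFinset_card_of_nodup hσC.1.1]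
    exact Finset.card_le_card fun x hx => ((hmemC x).1 (List.mem_toFinset.1 hx)).2
  have hm := hcount.trans (card_incidentEdges_le hD)
  have hp := card_throughPairs_le hD
  rw [cost_append, cost_append]
  have h₁ := (add_le_add hcostL hcostRM).trans_eq (mul_add _ _ _).symm
  have h₂ := h₁.trans (Nat.mul_le_mul_left C.card hm)
  have h₃ := hcostC.trans
    (Nat.mul_le_mul hp (Nat.mul_le_mul hlen (Nat.add_le_add_right hlen 1)))
  linarith [h₂, h₃]

theorem isApproximation_of_le {D : CompGraph V} (hD : D.IsCompDAG) {C : Finset V}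
    (hC : D.IsSeparator C) {ρ : ℝ} (hρ : ((C.card : ℝ) ^ 2 + 5 * C.card) / 2 ≤ ρ) :
    D.IsApproximation (D.IsMiddleOut C) ρ := by
  refine ⟨exists_isMiddleOut hD C, fun σ hσ => ?_⟩
  obtain ⟨htot, hcost⟩ := hσ.isTotalSeq_and_cost_le hD hC
  refine ⟨htot, ?_⟩
  have hcost' : 2 * (D.cost σ : ℝ) ≤ ((C.card : ℝ) ^ 2 + 5 * C.card) * D.opt := by
    exact_mod_cast hcost
  have := mul_le_mul_of_nonneg_right hρ (Nat.cast_nonneg (α := ℝ) D.opt)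
  linarith

end CompGraph

theorem mainTheorem2 :
    (∃ K : ℝ, ∀ (V : Type*) [DecidableEq V] (D : CompGraph V) (C : Finset V),
      D.IsCompDAG → D.IsSeparator C →
        D.IsApproximation (D.IsMiddleOut C) (K * (C.card : ℝ) ^ 2)) ∧
    (∀ (V : Type*) [DecidableEq V] (D : CompGraph V) (C : Finset V),
      D.IsCompDAG → D.IsSeparator C →
        D.IsApproximation (D.IsMiddleOut C) (((C.card : ℝ) ^ 2 + 7 * (C.card : ℝ)) / 2)) := by
  constructor
  · -- `(k² + 5k) / 2 ≤ 3k²`, because `k ≤ k²` for natural numbers.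
    refine ⟨3, fun V _ D C hD hC => CompGraph.isApproximation_of_le hD hC ?_⟩
    have : (C.card : ℝ) ≤ (C.card : ℝ) ^ 2 := by
      exact_mod_cast Nat.le_self_pow two_ne_zero C.card
    linarith
  · intro V _ D C hD hC
    refine CompGraph.isApproximation_of_le hD hC ?_
    linarith [Nat.cast_nonneg (α := ℝ) C.card]
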